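/- Let $A,Q\in\mathbb{R}^{n_x\times n_x}$, $B\in\mathbb{R}^{n_x\times n_u}$, $R\in\mathbb{R}^{n_u\times n_u}$ and $S\in\mathbb{R}^{n_u\times n_x}$, where $\begin{bmatrix}Q&S^\top\\ S&R\end{bmatrix}$ is symmetric positive semidefinite. Consider the system $x_{t+1}=Ax_t+Bu_t+w_t$, $t\ge 0$, with a deterministic initial state $x_0$ and random disturbances $w_t\in\mathbb{R}^{n_x}$, where $\mathbb{E}w_t=0$ and $\mathbb{E}w_sw_t^\top$ equals $I$ if $s=t$ and $0$ otherwise. The cost of a controller is $$C=\lim_{T\to\infty}\frac1T\,\mathbb{E}\sum_{t=0}^{T-1}\left(x_t^\top Qx_t+u_t^\top Ru_t+2u_t^\top Sx_t\right).$$ Write $C(K)$ for the cost of the state feedback controller $u_t=Kx_t$, and $C(L_1,\dots,L_H)$ for the cost of the disturbance response controller (DRC) $u_t=L_1w_{t-1}+\cdots+L_Hw_{t-H}$, where $w_s=0$ for $s<0$. Let $\|\cdot\|$ be the matrix $\ell_2$ (operator) norm, and call a square matrix $X$ $(\tau,\gamma)$-stable if $\|X^k\|\le\tau\gamma^k$ for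 all $k\ge 0$. Let $\rho>0$ and suppose that $A$ is $(\tau,e^{-\rho})$-stable. Let $K\in\mathbb{R}^{n_u\times n_x}$ be such that $A+BK$ is $(\tau,e^{-\rho})$-stable, and put $L_{K;h}=K(A+BK)^{h-1}$ for $h\ge 1$. Then for every integer $H\ge 0$ the limits defining $C(L_{K;1},\dots,L_{K;H})$ and $C(K)$ exist and are finite, and $$C(L_{K;1},\dots,L_{K;H})-C(K)\le n_x^2e^{-2\rho H}\left(\|R\|+\frac{4\tau^4\left(\|B\|\|K\|^2+\|K\|\right)\left(\|B\|\|Q\|+\|S\|\right)}{(1-e^{-2\rho})^3}\right).$$ -/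

import Mathlib

open MeasureTheory Filter Topology
-- the norm of a matrix is its l2 operator norm
open scoped Matrix Matrix.Norms.L2Operator

noncomputable section

namespace LQR

/-- `X` is `(τ, γ)`-stable: `‖X ^ k‖ ≤ τ * γ ^ k` for all `k ≥ 0`. -/
def IsStable {n : ℕ} (X : Matrix (Fin n) (Fin n) ℝ) (τ γ : ℝ) : Prop :=
  ∀ k : ℕ, ‖X ^ k‖ ≤ τ * γ ^ k

/-- A square-integrable process with zero mean, identity covariance and no correlation in time
(for instance, an i.i.d. sequence of centred random vectors with identity covariance). -/
structure IsWhiteNoise {Ω : Type*} [MeasurableSpace Ω] (μ : Measure Ω) {n : ℕ}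
    (w : ℕ → Ω → (Fin n → ℝ)) : Prop where
  memLp : ∀ t i, MemLp (fun ω => w t ω i) 2 μ
  mean_zero : ∀ t i, ∫ ω, w t ω i ∂μ = 0
  covariance : ∀ s t i j, ∫ ω, w s ω i * w t ω j ∂μ = if s = t ∧ i = j then 1 else 0

/-- The state driven by an input sequence: `x_{t+1} = A x_t + B u_t + w_t`. -/
def state {n m : ℕ} (A : Matrix (Fin n) (Fin n) ℝ) (B : Matrix (Fin n) (Fin m) ℝ)
    (x₀ : Fin n → ℝ) (u : ℕ → (Fin m → ℝ)) (w : ℕ → (Fin n → ℝ)) : ℕ → (Fin n → ℝ)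
  | 0 => x₀
  | t + 1 => A *ᵥ state A B x₀ u w t + B *ᵥ u t + w t

/-- The state under the state feedback `u_t = K x_t`:
`x_{t+1} = A x_t + B (K x_t) + w_t`. -/
def feedbackState {n m : ℕ} (A : Matrix (Fin n) (Fin n) ℝ) (B : Matrix (Fin n) (Fin m) ℝ)
    (K : Matrix (Fin m) (Fin n) ℝ)
    (x₀ : Fin n → ℝ) (w : ℕ → (Fin n → ℝ)) : ℕ → (Fin n → ℝ)
  | 0 => x₀
  | t + 1 => A *ᵥ feedbackState A B K x₀ w t + B *ᵥ (K *ᵥ feedbackState A B K x₀ w t) + w t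

/-- The input of the disturbance response controller with gains `L 1, …, L H`:
`u_t = L_1 w_{t-1} + ⋯ + L_H w_{t-H}`, where `w_s = 0` for `s < 0`. -/
def drcInput {n m : ℕ} (H : ℕ) (L : ℕ → Matrix (Fin m) (Fin n) ℝ)
    (w : ℕ → (Fin n → ℝ)) (t : ℕ) : Fin m → ℝ :=
  ∑ h ∈ Finset.Icc 1 H, if h ≤ t then L h *ᵥ w (t - h) else 0

/-- The gains `L_{K;h} = K (A + B K)^(h-1)`, for `h ≥ 1`, of the disturbance response controller
equivalent to `K` (the value at `h = 0` is never used). -/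
def equivalentDRC {n m : ℕ} (A : Matrix (Fin n) (Fin n) ℝ) (B : Matrix (Fin n) (Fin m) ℝ)
    (K : Matrix (Fin m) (Fin n) ℝ) (h : ℕ) : Matrix (Fin m) (Fin n) ℝ :=
  K * (A + B * K) ^ (h - 1)

/-- `xᵀ Q x + uᵀ R u + 2 uᵀ S x`. -/
def stageCost {n m : ℕ} (Q : Matrix (Fin n) (Fin n) ℝ) (R : Matrix (Fin m) (Fin m) ℝ)
    (S : Matrix (Fin m) (Fin n) ℝ) (x : Fin n → ℝ) (u : Fin m → ℝ) : ℝ :=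
  x ⬝ᵥ (Q *ᵥ x) + u ⬝ᵥ (R *ᵥ u) + 2 * (u ⬝ᵥ (S *ᵥ x))

/-- The stage costs along the processes `x`, `u` are integrable, and the limit of
`(1 / T) 𝔼 ∑_{t < T} (x_tᵀ Q x_t + u_tᵀ R u_t + 2 u_tᵀ S x_t)` as `T → ∞` exists and is `c`. -/
def HasAverageCost {Ω : Type*} [MeasurableSpace Ω] (μ : Measure Ω) {n m : ℕ}
    (Q : Matrix (Fin n) (Fin n) ℝ) (R : Matrix (Fin m) (Fin m) ℝ) (S : Matrix (Fin m) (Fin n) ℝ)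
    (x : ℕ → Ω → (Fin n → ℝ)) (u : ℕ → Ω → (Fin m → ℝ)) (c : ℝ) : Prop :=
  (∀ t, Integrable (fun ω => stageCost Q R S (x t ω) (u t ω)) μ) ∧
  Tendsto (fun T : ℕ => (1 / (T : ℝ)) *
      ∫ ω, ∑ t ∈ Finset.range T, stageCost Q R S (x t ω) (u t ω) ∂μ) atTop (𝓝 c)

/-- `c` is the cost `C(K)` of the state feedback controller `u_t = K x_t`. -/
def HasFeedbackCost {Ω : Type*} [MeasurableSpace Ω] (μ : Measure Ω) {n m : ℕ}
    (A : Matrix (Fin n) (Fin n) ℝ) (B : Matrix (Fin n) (Fin m) ℝ)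
    (Q : Matrix (Fin n) (Fin n) ℝ) (R : Matrix (Fin m) (Fin m) ℝ) (S : Matrix (Fin m) (Fin n) ℝ)
    (x₀ : Fin n → ℝ) (w : ℕ → Ω → (Fin n → ℝ)) (K : Matrix (Fin m) (Fin n) ℝ) (c : ℝ) : Prop :=
  HasAverageCost μ Q R S
    (fun t ω => feedbackState A B K x₀ (fun s => w s ω) t)
    (fun t ω => K *ᵥ feedbackState A B K x₀ (fun s => w s ω) t) c

/-- `c` is the cost `C(L)` of the disturbance response controller of order `H` with gains
`L 1, …, L H`. -/
def HasDRCCost {Ω : Type*} [MeasurableSpace Ω] (μ : Measure Ω) {n m : ℕ}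
    (A : Matrix (Fin n) (Fin n) ℝ) (B : Matrix (Fin n) (Fin m) ℝ)
    (Q : Matrix (Fin n) (Fin n) ℝ) (R : Matrix (Fin m) (Fin m) ℝ) (S : Matrix (Fin m) (Fin n) ℝ)
    (x₀ : Fin n → ℝ) (w : ℕ → Ω → (Fin n → ℝ))
    (H : ℕ) (L : ℕ → Matrix (Fin m) (Fin n) ℝ) (c : ℝ) : Prop :=
  HasAverageCost μ Q R S
    (fun t ω => state A B x₀ (drcInput H L (fun s => w s ω)) (fun s => w s ω) t)
    (fun t ω => drcInput H L (fun s => w s ω) t) c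

end LQR

end

/-!
States and inputs of both controllers respond affinely to the disturbances, and the disturbances
are white, so each average cost is the sum over all delays `j` of the cost of the gains with which
a disturbance acts `j` steps later. For the first `H` steps the disturbance response controller
has the gains of the feedback `K`; afterwards its input vanishes. The excess cost is therefore that
of switching to zero input after `H` steps.

With zero input the cost-to-go is the quadratic form of the solution `P` of the Lyapunov equation
`P = Q + Aᵀ P A`. Follow this form along the trajectory of `K`: by completing the square, its
decrease over one step exceeds the stage cost by at most twice the cross term
`Gᵀ (S + Bᵀ P A) F`, because `R + Bᵀ P B ⪰ 0`. Summing over the steps telescopes, and the cross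
terms decay geometrically since both states and inputs do.
-/

namespace LQR

section Trace

variable {k l n : Type*} [Fintype k] [Fintype l] [Fintype n]

lemma dotProduct_mulVec_eq_sum (N : Matrix k l ℝ) (x : k → ℝ) (y : l → ℝ) :
    x ⬝ᵥ (N *ᵥ y) = ∑ i, ∑ j, N i j * (x i * y j) := by
  simp only [dotProduct, Matrix.mulVec, Finset.mul_sum, mul_left_comm]

lemma trace_transpose_mul_mul_eq_sum (N : Matrix k l ℝ) (F : Matrix k n ℝ) (G : Matrix l n ℝ) :
    (Fᵀ * N * G).trace = ∑ i, ∑ j, N i j * (F * Gᵀ) i j := by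
  calc (Fᵀ * N * G).trace = (N * (F * Gᵀ)ᵀ).trace := by
        rw [Matrix.mul_assoc, Matrix.trace_mul_comm, Matrix.transpose_mul,
          Matrix.transpose_transpose, Matrix.mul_assoc]
    _ = ∑ i, ∑ j, N i j * (F * Gᵀ) i j := by
        simp only [Matrix.trace, Matrix.diag_apply, Matrix.mul_apply (M := N),
          Matrix.transpose_apply]

lemma trace_transpose_mul_mul_comm {P : Matrix k k ℝ} (hP : Pᵀ = P) (X Y : Matrix k n ℝ) :
    (Xᵀ * P * Y).trace = (Yᵀ * P * X).trace := by
  rw [← Matrix.trace_transpose]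
  simp only [Matrix.transpose_mul, Matrix.transpose_transpose, hP, Matrix.mul_assoc]

lemma trace_transpose_add_mul_add {P : Matrix k k ℝ} (hP : Pᵀ = P) (X Y : Matrix k n ℝ) :
    ((X + Y)ᵀ * P * (X + Y)).trace
      = (Xᵀ * P * X).trace + 2 * (Yᵀ * P * X).trace + (Yᵀ * P * Y).trace := by
  simp only [Matrix.transpose_add, Matrix.add_mul, Matrix.mul_add, Matrix.trace_add,
    trace_transpose_mul_mul_comm hP X Y]
  ring

lemma trace_transpose_mul_mul_nonneg {P : Matrix k k ℝ} (hP : P.PosSemidef) (Y : Matrix k n ℝ) :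
    0 ≤ (Yᵀ * P * Y).trace := by
  classical
  simpa using (hP.conjTranspose_mul_mul_same Y).trace_nonneg

variable [DecidableEq n]

lemma norm_transpose [DecidableEq k] (X : Matrix k n ℝ) : ‖Xᵀ‖ = ‖X‖ := by
  rw [← Matrix.conjTranspose_eq_transpose_of_trivial, Matrix.l2_opNorm_conjTranspose]

lemma abs_apply_le_norm (X : Matrix k n ℝ) (i : k) (j : n) : |X i j| ≤ ‖X‖ := by
  simpa using (PiLp.norm_apply_le (WithLp.toLp 2 (X *ᵥ Pi.single j 1)) i).trans
    (X.l2_opNorm_mulVec (EuclideanSpace.single j 1))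

lemma abs_trace_le (X : Matrix n n ℝ) : |X.trace| ≤ Fintype.card n * ‖X‖ :=
  calc |X.trace| ≤ ∑ i, |X i i| := Finset.abs_sum_le_sum_abs _ _
    _ ≤ ∑ _i : n, ‖X‖ := Finset.sum_le_sum fun i _ => abs_apply_le_norm X i i
    _ = Fintype.card n * ‖X‖ := by simp

lemma norm_transpose_mul_mul_le [DecidableEq l] (F : Matrix k n ℝ) (N : Matrix k l ℝ)
    (G : Matrix l n ℝ) : ‖Fᵀ * N * G‖ ≤ ‖F‖ * ‖N‖ * ‖G‖ := by
  classical
  calc ‖Fᵀ * N * G‖ ≤ ‖Fᵀ * N‖ * ‖G‖ := Matrix.l2_opNorm_mul _ _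
    _ ≤ ‖Fᵀ‖ * ‖N‖ * ‖G‖ := by gcongr; exact Matrix.l2_opNorm_mul _ _
    _ = ‖F‖ * ‖N‖ * ‖G‖ := by rw [norm_transpose]

lemma abs_trace_transpose_mul_mul_le [DecidableEq l] (F : Matrix k n ℝ) (N : Matrix k l ℝ)
    (G : Matrix l n ℝ) : |(Fᵀ * N * G).trace| ≤ Fintype.card n * (‖F‖ * ‖N‖ * ‖G‖) :=
  (abs_trace_le _).trans (by gcongr; exact norm_transpose_mul_mul_le F N G)

lemma summable_trace_transpose_mul_mul (N : Matrix k l ℝ) {F : ℕ → Matrix k n ℝ}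
    {G : ℕ → Matrix l n ℝ} {a b γ : ℝ} (hγ0 : 0 ≤ γ) (hγ1 : γ < 1)
    (hF : ∀ j, ‖F j‖ ≤ a * γ ^ j) (hG : ∀ j, ‖G j‖ ≤ b * γ ^ j) :
    Summable fun j => ((F j)ᵀ * N * G j).trace := by
  classical
  have hγ2 : γ ^ 2 < 1 := pow_lt_one₀ hγ0 hγ1 two_ne_zero
  refine Summable.of_norm_bounded
    (g := fun j => Fintype.card n * (a * ‖N‖ * b) * (γ ^ 2) ^ j)
    ((summable_geometric_of_lt_one (sq_nonneg γ) hγ2).mul_left _) fun j => ?_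
  have ha : 0 ≤ a * γ ^ j := (norm_nonneg _).trans (hF j)
  calc ‖((F j)ᵀ * N * G j).trace‖ ≤ Fintype.card n * (‖F j‖ * ‖N‖ * ‖G j‖) :=
        abs_trace_transpose_mul_mul_le (F j) N (G j)
    _ ≤ Fintype.card n * (a * γ ^ j * ‖N‖ * (b * γ ^ j)) := by gcongr; exacts [hF j, hG j]
    _ = Fintype.card n * (a * ‖N‖ * b) * (γ ^ 2) ^ j := by ring

end Trace

section SecondMoment

variable {Ω : Type*} [MeasurableSpace Ω] {μ : Measure Ω}

section Affine

variable {ι : Type*} {s : Finset ι} {ξ : ι → Ω → ℝ}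

lemma memLp_affine [IsFiniteMeasure μ] (hξ : ∀ p ∈ s, MemLp (ξ p) 2 μ) (a : ℝ) (c : ι → ℝ) :
    MemLp (fun ω => a + ∑ p ∈ s, c p * ξ p ω) 2 μ :=
  (memLp_const a).add (memLp_finsetSum s fun p hp => (hξ p hp).const_mul (c p))

lemma integral_affine [IsProbabilityMeasure μ] (hξ : ∀ p ∈ s, Integrable (ξ p) μ)
    (hmean : ∀ p ∈ s, ∫ ω, ξ p ω ∂μ = 0) (a : ℝ) (c : ι → ℝ) :
    ∫ ω, a + ∑ p ∈ s, c p * ξ p ω ∂μ = a := by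
  rw [integral_add (integrable_const a) (integrable_finsetSum s fun p hp => (hξ p hp).const_mul _),
    integral_finsetSum _ fun p hp => (hξ p hp).const_mul _]
  simp +contextual [integral_const_mul, hmean]

open ProbabilityTheory in
lemma integral_affine_mul_affine [IsProbabilityMeasure μ] [DecidableEq ι]
    (hξ : ∀ p ∈ s, MemLp (ξ p) 2 μ) (hmean : ∀ p ∈ s, ∫ ω, ξ p ω ∂μ = 0)
    (hcov : ∀ p ∈ s, ∀ q ∈ s, ∫ ω, ξ p ω * ξ q ω ∂μ = if p = q then 1 else 0)
    (a b : ℝ) (c d : ι → ℝ) :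
    ∫ ω, (a + ∑ p ∈ s, c p * ξ p ω) * (b + ∑ p ∈ s, d p * ξ p ω) ∂μ
      = a * b + ∑ p ∈ s, c p * d p := by
  have hterm (e : ι → ℝ) : ∀ p ∈ s, MemLp (fun ω => e p * ξ p ω) 2 μ :=
    fun p hp => (hξ p hp).const_mul (e p)
  have hlin (e : ι → ℝ) : Integrable (fun ω => ∑ p ∈ s, e p * ξ p ω) μ :=
    (memLp_finsetSum s (hterm e)).integrable one_le_two
  have hmean' (a : ℝ) (e : ι → ℝ) : ∫ ω, a + ∑ p ∈ s, e p * ξ p ω ∂μ = a :=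
    integral_affine (fun p hp => (hξ p hp).integrable one_le_two) hmean a e
  have hξcov : ∀ p ∈ s, ∀ q ∈ s, cov[ξ p, ξ q; μ] = if p = q then 1 else 0 := fun p hp q hq => by
    rw [covariance_eq_sub (hξ p hp) (hξ q hq), hmean p hp, hmean q hq, zero_mul, sub_zero]
    exact hcov p hp q hq
  have hcov' : cov[fun ω => a + ∑ p ∈ s, c p * ξ p ω, fun ω => b + ∑ p ∈ s, d p * ξ p ω; μ]
      = ∑ p ∈ s, c p * d p := by
    rw [covariance_const_add_left (hlin c), covariance_const_add_right (hlin d),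
      covariance_fun_sum_fun_sum' (hterm c) (hterm d)]
    refine Finset.sum_congr rfl fun p hp => ?_
    simp_rw [covariance_const_mul_left, covariance_const_mul_right]
    rw [Finset.sum_congr rfl fun q hq => by rw [hξcov p hp q hq]]
    simp [hp]
  rw [covariance_eq_sub (memLp_affine hξ a c) (memLp_affine hξ b d), hmean', hmean'] at hcov'
  simpa only [Pi.mul_apply, sub_eq_iff_eq_add'] using hcov'

end Affine

section Bilinear

variable {k l : Type*} [Fintype k] [Fintype l] {x : Ω → k → ℝ} {y : Ω → l → ℝ}

lemma integrable_dotProduct_mulVec (N : Matrix k l ℝ) (hx : ∀ i, MemLp (fun ω => x ω i) 2 μ)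
    (hy : ∀ j, MemLp (fun ω => y ω j) 2 μ) : Integrable (fun ω => x ω ⬝ᵥ (N *ᵥ y ω)) μ := by
  simp only [dotProduct_mulVec_eq_sum]
  exact integrable_finsetSum _ fun i _ => integrable_finsetSum _ fun j _ =>
    ((hx i).integrable_mul (hy j)).const_mul (N i j)

lemma integral_dotProduct_mulVec (N : Matrix k l ℝ) (hx : ∀ i, MemLp (fun ω => x ω i) 2 μ)
    (hy : ∀ j, MemLp (fun ω => y ω j) 2 μ) :
    ∫ ω, x ω ⬝ᵥ (N *ᵥ y ω) ∂μ = ∑ i, ∑ j, N i j * ∫ ω, x ω i * y ω j ∂μ := by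
  have hint i j : Integrable (fun ω => N i j * (x ω i * y ω j)) μ :=
    ((hx i).integrable_mul (hy j)).const_mul (N i j)
  simp only [dotProduct_mulVec_eq_sum]
  rw [integral_finsetSum _ fun i _ => integrable_finsetSum _ fun j _ => hint i j]
  simp only [integral_finsetSum _ fun j _ => hint _ j, integral_const_mul]

end Bilinear

end SecondMoment

section GainCost

variable {k l n : Type*} [Fintype k] [Fintype l] [Fintype n]

/-- The expected stage cost caused by a white disturbance that acts on the state through the
gain `F` and on the input through the gain `G`. -/
def gainCost (Q : Matrix k k ℝ) (R : Matrix l l ℝ) (S : Matrix l k ℝ) (F : Matrix k n ℝ)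
    (G : Matrix l n ℝ) : ℝ :=
  (Fᵀ * Q * F).trace + (Gᵀ * R * G).trace + 2 * (Gᵀ * S * F).trace

lemma gainCost_zero_right (Q : Matrix k k ℝ) (R : Matrix l l ℝ) (S : Matrix l k ℝ)
    (F : Matrix k n ℝ) : gainCost Q R S F 0 = (Fᵀ * Q * F).trace := by
  simp [gainCost]

lemma summable_gainCost [DecidableEq n] (Q : Matrix k k ℝ) (R : Matrix l l ℝ) (S : Matrix l k ℝ)
    {F : ℕ → Matrix k n ℝ} {G : ℕ → Matrix l n ℝ} {a b γ : ℝ} (hγ0 : 0 ≤ γ) (hγ1 : γ < 1)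
    (hF : ∀ j, ‖F j‖ ≤ a * γ ^ j) (hG : ∀ j, ‖G j‖ ≤ b * γ ^ j) :
    Summable fun j => gainCost Q R S (F j) (G j) :=
  ((summable_trace_transpose_mul_mul Q hγ0 hγ1 hF hF).add
    (summable_trace_transpose_mul_mul R hγ0 hγ1 hG hG)).add
    ((summable_trace_transpose_mul_mul S hγ0 hγ1 hG hF).mul_left 2)

/-- Completing the square: `(A F + B G)ᵀ P (A F + B G)` is the cost-to-go after one step, and when
`P` and `R` are positive semidefinite only the last, cross term can be negative. -/
lemma gainCost_eq_trace_sub_trace_add {A P Q : Matrix k k ℝ} (hPt : Pᵀ = P)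
    (hP : P = Q + Aᵀ * P * A) (B : Matrix k l ℝ) (R : Matrix l l ℝ) (S : Matrix l k ℝ)
    (F : Matrix k n ℝ) (G : Matrix l n ℝ) :
    gainCost Q R S F G
      = (Fᵀ * P * F).trace - ((A * F + B * G)ᵀ * P * (A * F + B * G)).trace
        + (Gᵀ * (R + Bᵀ * P * B) * G).trace + 2 * (Gᵀ * (S + Bᵀ * P * A) * F).trace := by
  have hF : (Fᵀ * P * F).trace = (Fᵀ * Q * F).trace + ((A * F)ᵀ * P * (A * F)).trace := by
    conv_lhs => rw [hP]
    simp only [Matrix.mul_add, Matrix.add_mul, Matrix.trace_add, Matrix.transpose_mul,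
      Matrix.mul_assoc]
  rw [hF, trace_transpose_add_mul_add hPt, gainCost]
  simp only [Matrix.mul_add, Matrix.add_mul, Matrix.trace_add, Matrix.transpose_mul,
    Matrix.mul_assoc]
  ring

lemma trace_sub_trace_le_gainCost_add [DecidableEq k] [DecidableEq n] {A P Q : Matrix k k ℝ}
    {R : Matrix l l ℝ} (hP0 : P.PosSemidef) (hR : R.PosSemidef) (hP : P = Q + Aᵀ * P * A)
    (B : Matrix k l ℝ) (S : Matrix l k ℝ) (F : Matrix k n ℝ) (G : Matrix l n ℝ) :
    (Fᵀ * P * F).trace - ((A * F + B * G)ᵀ * P * (A * F + B * G)).trace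
      ≤ gainCost Q R S F G + 2 * (Fintype.card n * (‖G‖ * ‖S + Bᵀ * P * A‖ * ‖F‖)) := by
  have hPt : Pᵀ = P := by simpa using hP0.isHermitian.eq
  have hRP : (R + Bᵀ * P * B).PosSemidef := by
    simpa using hR.add (hP0.conjTranspose_mul_mul_same B)
  have hquad := trace_transpose_mul_mul_nonneg hRP G
  have hcross := neg_le_of_abs_le (abs_trace_transpose_mul_mul_le G (S + Bᵀ * P * A) F)
  rw [gainCost_eq_trace_sub_trace_add hPt hP B R S F G]
  linarith

end GainCost

section Response

variable {k l n : Type*} [Fintype n]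

/-- The affine response `a + F 0 w_{t-1} + F 1 w_{t-2} + ⋯ + F (t-1) w_0` to the disturbances: the
gain `F j` acts with delay `j + 1`. Both the states and the inputs of a closed loop have this
form. -/
def response (a : k → ℝ) (F : ℕ → Matrix k n ℝ) (w : ℕ → n → ℝ) (t : ℕ) : k → ℝ :=
  a + ∑ j ∈ Finset.range t, F j *ᵥ w (t - (j + 1))

lemma response_apply (a : k → ℝ) (F : ℕ → Matrix k n ℝ) (w : ℕ → n → ℝ) (t : ℕ) (i : k) :
    response a F w t i
      = a i + ∑ p ∈ Finset.range t ×ˢ Finset.univ, F p.1 i p.2 * w (t - (p.1 + 1)) p.2 := by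
  simp [response, Finset.sum_product, Matrix.mulVec, dotProduct]

lemma response_succ (a : k → ℝ) (F : ℕ → Matrix k n ℝ) (w : ℕ → n → ℝ) (t : ℕ) :
    response a F w (t + 1) = response a (fun j => F (j + 1)) w t + F 0 *ᵥ w t := by
  simp [response, Finset.sum_range_succ', add_assoc]

lemma response_add (a b : k → ℝ) (F G : ℕ → Matrix k n ℝ) (w : ℕ → n → ℝ) (t : ℕ) :
    response a F w t + response b G w t = response (a + b) (fun j => F j + G j) w t := by
  simp only [response, Matrix.add_mulVec, Finset.sum_add_distrib]
  abel

lemma mulVec_response [Fintype k] (N : Matrix l k ℝ) (a : k → ℝ) (F : ℕ → Matrix k n ℝ)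
    (w : ℕ → n → ℝ) (t : ℕ) :
    N *ᵥ response a F w t = response (N *ᵥ a) (fun j => N * F j) w t := by
  simp [response, Matrix.mulVec_add, Matrix.mulVec_sum, Matrix.mulVec_mulVec]

end Response

section WhiteNoise

variable {Ω : Type*} [MeasurableSpace Ω] {μ : Measure Ω} {n : ℕ} {w : ℕ → Ω → (Fin n → ℝ)}

section

variable {k l : Type*}

lemma IsWhiteNoise.memLp_response [IsFiniteMeasure μ] (hw : IsWhiteNoise μ w) (a : k → ℝ)
    (F : ℕ → Matrix k (Fin n) ℝ) (t : ℕ) (i : k) :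
    MemLp (fun ω => response a F (fun s => w s ω) t i) 2 μ := by
  simp only [response_apply]
  exact memLp_affine (ξ := fun (p : ℕ × Fin n) ω => w (t - (p.1 + 1)) ω p.2)
    (fun p _ => hw.memLp _ _) (a i) fun p => F p.1 i p.2

variable [IsProbabilityMeasure μ]

lemma IsWhiteNoise.integral_response_mul_response (hw : IsWhiteNoise μ w) (a : k → ℝ) (b : l → ℝ)
    (F : ℕ → Matrix k (Fin n) ℝ) (G : ℕ → Matrix l (Fin n) ℝ) (t : ℕ) (i : k) (j : l) :
    ∫ ω, response a F (fun s => w s ω) t i * response b G (fun s => w s ω) t j ∂μ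
      = a i * b j + ∑ r ∈ Finset.range t, (F r * (G r)ᵀ) i j := by
  simp only [response_apply]
  rw [integral_affine_mul_affine (ξ := fun (p : ℕ × Fin n) ω => w (t - (p.1 + 1)) ω p.2)
    (fun p _ => hw.memLp _ _) (fun p _ => hw.mean_zero _ _) ?_ (a i) (b j)
    (fun p => F p.1 i p.2) (fun p => G p.1 j p.2)]
  · simp only [Finset.sum_product, Matrix.mul_apply, Matrix.transpose_apply]
  · intro p hp q hq
    have hp' : p.1 < t := by simpa using hp
    have hq' : q.1 < t := by simpa using hq
    have hdelay : t - (p.1 + 1) = t - (q.1 + 1) ↔ p.1 = q.1 := by omega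
    simp only [hw.covariance, hdelay, Prod.ext_iff]

variable [Fintype k] [Fintype l]

lemma IsWhiteNoise.integral_dotProduct_mulVec_response (hw : IsWhiteNoise μ w) (N : Matrix k l ℝ)
    (a : k → ℝ) (b : l → ℝ) (F : ℕ → Matrix k (Fin n) ℝ) (G : ℕ → Matrix l (Fin n) ℝ) (t : ℕ) :
    ∫ ω, response a F (fun s => w s ω) t ⬝ᵥ (N *ᵥ response b G (fun s => w s ω) t) ∂μ
      = a ⬝ᵥ (N *ᵥ b) + ∑ r ∈ Finset.range t, ((F r)ᵀ * N * G r).trace := by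
  rw [integral_dotProduct_mulVec N (hw.memLp_response a F t) (hw.memLp_response b G t)]
  simp only [hw.integral_response_mul_response, trace_transpose_mul_mul_eq_sum,
    dotProduct_mulVec_eq_sum, mul_add, Finset.sum_add_distrib, Finset.mul_sum]
  congr 1
  rw [Finset.sum_comm' (t' := Finset.univ) (s' := fun _ => Finset.range t) (by simp)]
  refine Finset.sum_congr rfl fun i _ => ?_
  exact Finset.sum_comm

end

variable {m : ℕ} {Q : Matrix (Fin n) (Fin n) ℝ} {R : Matrix (Fin m) (Fin m) ℝ}
  {S : Matrix (Fin m) (Fin n) ℝ}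

lemma HasAverageCost.of_tendsto_integral_stageCost {x : ℕ → Ω → (Fin n → ℝ)}
    {u : ℕ → Ω → (Fin m → ℝ)} {c : ℝ}
    (hint : ∀ t, Integrable (fun ω => stageCost Q R S (x t ω) (u t ω)) μ)
    (hlim : Tendsto (fun t => ∫ ω, stageCost Q R S (x t ω) (u t ω) ∂μ) atTop (𝓝 c)) :
    HasAverageCost μ Q R S x u c := by
  refine ⟨hint, hlim.cesaro.congr fun T => ?_⟩
  rw [integral_finsetSum _ fun t _ => hint t, one_div]

lemma continuous_stageCost :
    Continuous fun p : (Fin n → ℝ) × (Fin m → ℝ) => stageCost Q R S p.1 p.2 := by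
  unfold stageCost
  fun_prop

lemma integrable_stageCost {x : Ω → (Fin n → ℝ)} {u : Ω → (Fin m → ℝ)}
    (hx : ∀ i, MemLp (fun ω => x ω i) 2 μ) (hu : ∀ i, MemLp (fun ω => u ω i) 2 μ) :
    Integrable (fun ω => stageCost Q R S (x ω) (u ω)) μ :=
  ((integrable_dotProduct_mulVec Q hx hx).add (integrable_dotProduct_mulVec R hu hu)).add
    ((integrable_dotProduct_mulVec S hu hx).const_mul 2)

lemma integral_stageCost {x : Ω → (Fin n → ℝ)} {u : Ω → (Fin m → ℝ)}
    (hx : ∀ i, MemLp (fun ω => x ω i) 2 μ) (hu : ∀ i, MemLp (fun ω => u ω i) 2 μ) :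
    ∫ ω, stageCost Q R S (x ω) (u ω) ∂μ
      = ∫ ω, x ω ⬝ᵥ (Q *ᵥ x ω) ∂μ + ∫ ω, u ω ⬝ᵥ (R *ᵥ u ω) ∂μ
        + 2 * ∫ ω, u ω ⬝ᵥ (S *ᵥ x ω) ∂μ := by
  have hQ := integrable_dotProduct_mulVec Q hx hx
  have hR := integrable_dotProduct_mulVec R hu hu
  have hS := integrable_dotProduct_mulVec S hu hx
  rw [← integral_const_mul, ← integral_add hQ hR]
  exact integral_add (hQ.add hR) (hS.const_mul 2)

variable [IsProbabilityMeasure μ]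

lemma IsWhiteNoise.integral_stageCost_response (hw : IsWhiteNoise μ w) (a : Fin n → ℝ)
    (b : Fin m → ℝ) (F : ℕ → Matrix (Fin n) (Fin n) ℝ) (G : ℕ → Matrix (Fin m) (Fin n) ℝ) (t : ℕ) :
    ∫ ω, stageCost Q R S (response a F (fun s => w s ω) t) (response b G (fun s => w s ω) t) ∂μ
      = stageCost Q R S a b + ∑ j ∈ Finset.range t, gainCost Q R S (F j) (G j) := by
  rw [integral_stageCost (hw.memLp_response a F t) (hw.memLp_response b G t)]
  simp only [hw.integral_dotProduct_mulVec_response, stageCost, gainCost, Finset.sum_add_distrib,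
    ← Finset.mul_sum]
  ring

lemma IsWhiteNoise.hasAverageCost_response (hw : IsWhiteNoise μ w)
    {a : ℕ → Fin n → ℝ} {b : ℕ → Fin m → ℝ} {F : ℕ → Matrix (Fin n) (Fin n) ℝ}
    {G : ℕ → Matrix (Fin m) (Fin n) ℝ} (ha : Tendsto a atTop (𝓝 0)) (hb : Tendsto b atTop (𝓝 0))
    {c : ℝ} (hc : HasSum (fun j => gainCost Q R S (F j) (G j)) c) :
    HasAverageCost μ Q R S (fun t ω => response (a t) F (fun s => w s ω) t)
      (fun t ω => response (b t) G (fun s => w s ω) t) c := by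
  refine .of_tendsto_integral_stageCost (fun t => integrable_stageCost
    (hw.memLp_response (a t) F t) (hw.memLp_response (b t) G t)) ?_
  simp only [hw.integral_stageCost_response]
  have htransient : Tendsto (fun t => stageCost Q R S (a t) (b t)) atTop (𝓝 0) := by
    simpa [stageCost, Function.comp_def] using
      (continuous_stageCost (Q := Q) (R := R) (S := S)).tendsto (0, 0) |>.comp (ha.prodMk_nhds hb)
  simpa only [zero_add] using htransient.add hc.tendsto_sum_nat

end WhiteNoise

section ClosedLoop

variable {n m : ℕ} {A : Matrix (Fin n) (Fin n) ℝ} {B : Matrix (Fin n) (Fin m) ℝ}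

/-- The gains from the disturbances to the state when the disturbances act on the input through
the gains `G`, both with the indexing of `response`. -/
def stateGain (A : Matrix (Fin n) (Fin n) ℝ) (B : Matrix (Fin n) (Fin m) ℝ)
    (G : ℕ → Matrix (Fin m) (Fin n) ℝ) : ℕ → Matrix (Fin n) (Fin n) ℝ
  | 0 => 1
  | j + 1 => A * stateGain A B G j + B * G j

lemma state_eq_response (x₀ : Fin n → ℝ) (G : ℕ → Matrix (Fin m) (Fin n) ℝ)
    (w : ℕ → (Fin n → ℝ)) (t : ℕ) :
    state A B x₀ (response 0 G w) w t = response (A ^ t *ᵥ x₀) (stateGain A B G) w t := by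
  induction t with
  | zero => simp [state, response]
  | succ t ih =>
    rw [state, ih, mulVec_response, mulVec_response, response_add, response_succ]
    simp [stateGain, Matrix.mulVec_mulVec, pow_succ']

lemma feedbackState_eq_response (K : Matrix (Fin m) (Fin n) ℝ) (x₀ : Fin n → ℝ)
    (w : ℕ → (Fin n → ℝ)) (t : ℕ) :
    feedbackState A B K x₀ w t
      = response ((A + B * K) ^ t *ᵥ x₀) (fun j => (A + B * K) ^ j) w t := by
  induction t with
  | zero => simp [feedbackState, response]
  | succ t ih =>
    rw [feedbackState, ih, Matrix.mulVec_mulVec, ← Matrix.add_mulVec, mulVec_response,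
      response_succ]
    simp [Matrix.mulVec_mulVec, pow_succ']

/-- The gains of `drcInput` with the indexing of `response`, that is, shifted by one. -/
def drcGain (H : ℕ) (L : ℕ → Matrix (Fin m) (Fin n) ℝ) (j : ℕ) : Matrix (Fin m) (Fin n) ℝ :=
  if j < H then L (j + 1) else 0

lemma drcInput_eq_response (H : ℕ) (L : ℕ → Matrix (Fin m) (Fin n) ℝ) (w : ℕ → (Fin n → ℝ)) :
    drcInput H L w = response 0 (drcGain H L) w := by
  funext t
  calc drcInput H L w t
      = ∑ j ∈ Finset.range H, if j + 1 ≤ t then L (j + 1) *ᵥ w (t - (j + 1)) else 0 := by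
        rw [drcInput, Finset.range_eq_Ico, ← Finset.Ico_add_one_right_eq_Icc,
          Finset.sum_Ico_add' (fun h => if h ≤ t then L h *ᵥ w (t - h) else 0) 0 H 1]
    _ = ∑ j ∈ Finset.range t, if j < H then L (j + 1) *ᵥ w (t - (j + 1)) else 0 := by
        rw [← Finset.sum_filter, ← Finset.sum_filter]
        exact Finset.sum_congr (by ext; simp [and_comm]) fun _ _ => rfl
    _ = response 0 (drcGain H L) w t := by
        rw [response, zero_add]
        refine Finset.sum_congr rfl fun j _ => ?_
        rw [drcGain]
        split_ifs <;> simp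

lemma stateGain_drcGain_equivalentDRC (K : Matrix (Fin m) (Fin n) ℝ) (H j : ℕ) :
    stateGain A B (drcGain H (equivalentDRC A B K)) j = A ^ (j - H) * (A + B * K) ^ min j H := by
  induction j with
  | zero => simp [stateGain]
  | succ j ih =>
    rw [stateGain, ih, drcGain]
    split_ifs with hj
    · rw [Nat.sub_eq_zero_of_le hj, Nat.sub_eq_zero_of_le hj.le, min_eq_left (Nat.succ_le_of_lt hj),
        min_eq_left hj.le, equivalentDRC, Nat.add_sub_cancel, pow_zero, Matrix.one_mul,
        Matrix.one_mul, pow_succ', Matrix.add_mul, Matrix.mul_assoc]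
    · rw [min_eq_right (by omega), min_eq_right (by omega), Nat.sub_add_comm (by omega), pow_succ',
        Matrix.mul_zero, add_zero, Matrix.mul_assoc]

lemma drcGain_equivalentDRC (K : Matrix (Fin m) (Fin n) ℝ) (H j : ℕ) :
    drcGain H (equivalentDRC A B K) j = if j < H then K * (A + B * K) ^ j else 0 :=
  rfl

end ClosedLoop

section Stability

variable {n m : ℕ} {A : Matrix (Fin n) (Fin n) ℝ} {B : Matrix (Fin n) (Fin m) ℝ}
  {K : Matrix (Fin m) (Fin n) ℝ} {τ γ : ℝ}

lemma IsStable.nonneg (hA : IsStable A τ γ) : 0 ≤ τ := by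
  simpa using (norm_nonneg _).trans (hA 0)

lemma IsStable.one_le (hA : IsStable A τ γ) (hn : 0 < n) : 1 ≤ τ := by
  have : NeZero n := ⟨hn.ne'⟩
  simpa using hA 0

lemma IsStable.tendsto_pow_mulVec (hA : IsStable A τ γ) (hγ0 : 0 ≤ γ) (hγ1 : γ < 1)
    (x : Fin n → ℝ) : Tendsto (fun t => A ^ t *ᵥ x) atTop (𝓝 0) := by
  have hpow : Tendsto (fun t => A ^ t) atTop (𝓝 0) := by
    refine squeeze_zero_norm hA ?_
    simpa using (tendsto_pow_atTop_nhds_zero_of_lt_one hγ0 hγ1).const_mul τ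
  have hcont : Continuous fun Y : Matrix (Fin n) (Fin n) ℝ => Y *ᵥ x := by fun_prop
  simpa [Function.comp_def] using (hcont.tendsto 0).comp hpow

lemma IsStable.norm_mul_pow_le (hA : IsStable A τ γ) (K : Matrix (Fin m) (Fin n) ℝ) (j : ℕ) :
    ‖K * A ^ j‖ ≤ ‖K‖ * τ * γ ^ j :=
  calc ‖K * A ^ j‖ ≤ ‖K‖ * ‖A ^ j‖ := Matrix.l2_opNorm_mul _ _
    _ ≤ ‖K‖ * (τ * γ ^ j) := by gcongr; exact hA j
    _ = ‖K‖ * τ * γ ^ j := by ring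

lemma IsStable.norm_drcGain_equivalentDRC_le (hK : IsStable (A + B * K) τ γ) (hγ0 : 0 ≤ γ)
    (H j : ℕ) : ‖drcGain H (equivalentDRC A B K) j‖ ≤ ‖K‖ * τ * γ ^ j := by
  have hτ := hK.nonneg
  rw [drcGain_equivalentDRC]
  split_ifs
  · exact hK.norm_mul_pow_le K j
  · rw [norm_zero]
    positivity

lemma IsStable.norm_stateGain_drcGain_equivalentDRC_le (hA : IsStable A τ γ)
    (hK : IsStable (A + B * K) τ γ) (H j : ℕ) :
    ‖stateGain A B (drcGain H (equivalentDRC A B K)) j‖ ≤ τ ^ 2 * γ ^ j := by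
  rw [stateGain_drcGain_equivalentDRC]
  calc ‖A ^ (j - H) * (A + B * K) ^ min j H‖
      ≤ ‖A ^ (j - H)‖ * ‖(A + B * K) ^ min j H‖ := norm_mul_le _ _
    _ ≤ τ * γ ^ (j - H) * (τ * γ ^ min j H) :=
        mul_le_mul (hA _) (hK _) (norm_nonneg _) ((norm_nonneg _).trans (hA _))
    _ = τ ^ 2 * γ ^ (j - H + min j H) := by ring
    _ = τ ^ 2 * γ ^ j := by congr 2; omega

end Stability

section Cost

variable {Ω : Type*} [MeasurableSpace Ω] {μ : Measure Ω} [IsProbabilityMeasure μ] {n m : ℕ}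
  {w : ℕ → Ω → (Fin n → ℝ)} {A : Matrix (Fin n) (Fin n) ℝ} {B : Matrix (Fin n) (Fin m) ℝ}
  {Q : Matrix (Fin n) (Fin n) ℝ} {R : Matrix (Fin m) (Fin m) ℝ}
  {S : Matrix (Fin m) (Fin n) ℝ} {τ γ c : ℝ}

lemma IsWhiteNoise.hasDRCCost (hw : IsWhiteNoise μ w) (hA : IsStable A τ γ) (hγ0 : 0 ≤ γ)
    (hγ1 : γ < 1) (x₀ : Fin n → ℝ) {H : ℕ} {L : ℕ → Matrix (Fin m) (Fin n) ℝ}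
    (hc : HasSum (fun j => gainCost Q R S (stateGain A B (drcGain H L) j) (drcGain H L j)) c) :
    HasDRCCost μ A B Q R S x₀ w H L c := by
  simp only [HasDRCCost, drcInput_eq_response, state_eq_response]
  exact hw.hasAverageCost_response (hA.tendsto_pow_mulVec hγ0 hγ1 x₀) tendsto_const_nhds hc

lemma IsWhiteNoise.hasFeedbackCost (hw : IsWhiteNoise μ w) {K : Matrix (Fin m) (Fin n) ℝ}
    (hK : IsStable (A + B * K) τ γ) (hγ0 : 0 ≤ γ) (hγ1 : γ < 1) (x₀ : Fin n → ℝ)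
    (hc : HasSum (fun j => gainCost Q R S ((A + B * K) ^ j) (K * (A + B * K) ^ j)) c) :
    HasFeedbackCost μ A B Q R S x₀ w K c := by
  have hx := hK.tendsto_pow_mulVec hγ0 hγ1 x₀
  have hcont : Continuous fun x : Fin n → ℝ => K *ᵥ x := by fun_prop
  have hu : Tendsto (fun t => K *ᵥ ((A + B * K) ^ t *ᵥ x₀)) atTop (𝓝 0) := by
    simpa [Function.comp_def] using (hcont.tendsto 0).comp hx
  simp only [HasFeedbackCost, feedbackState_eq_response, mulVec_response]
  exact hw.hasAverageCost_response hx hu hc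

end Cost

section Lyapunov

variable {n m : ℕ} {A : Matrix (Fin n) (Fin n) ℝ} {τ γ : ℝ}

/-- The solution `P = ∑ₖ (Aᵏ)ᵀ Q Aᵏ` of the Lyapunov equation `P = Q + Aᵀ P A`, the cost-to-go
matrix of the system with zero input. It is meaningful for stable `A` only: the sum is `0` when
the series diverges. -/
noncomputable def lyapunov (A Q : Matrix (Fin n) (Fin n) ℝ) : Matrix (Fin n) (Fin n) ℝ :=
  ∑' k, (A ^ k)ᵀ * Q * A ^ k

lemma IsStable.norm_transpose_pow_mul_mul_pow_le (hA : IsStable A τ γ)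
    (Q : Matrix (Fin n) (Fin n) ℝ) (k l : ℕ) :
    ‖(A ^ k)ᵀ * Q * A ^ l‖ ≤ τ ^ 2 * ‖Q‖ * γ ^ (k + l) :=
  calc ‖(A ^ k)ᵀ * Q * A ^ l‖ ≤ ‖A ^ k‖ * ‖Q‖ * ‖A ^ l‖ := norm_transpose_mul_mul_le _ _ _
    _ ≤ τ * γ ^ k * ‖Q‖ * (τ * γ ^ l) := by
        have := (norm_nonneg _).trans (hA k)
        gcongr
        exacts [hA k, hA l]
    _ = τ ^ 2 * ‖Q‖ * γ ^ (k + l) := by ring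

section

variable (hA : IsStable A τ γ) (hγ0 : 0 ≤ γ) (hγ1 : γ < 1) (Q : Matrix (Fin n) (Fin n) ℝ)
include hA hγ0 hγ1

lemma IsStable.hasSum_lyapunov : HasSum (fun k => (A ^ k)ᵀ * Q * A ^ k) (lyapunov A Q) := by
  have hγ2 : γ ^ 2 < 1 := pow_lt_one₀ hγ0 hγ1 two_ne_zero
  refine Summable.hasSum (Summable.of_norm_bounded
    ((summable_geometric_of_lt_one (sq_nonneg γ) hγ2).mul_left (τ ^ 2 * ‖Q‖)) fun k => ?_)
  exact (hA.norm_transpose_pow_mul_mul_pow_le Q k k).trans_eq (by ring)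

lemma IsStable.lyapunov_eq : lyapunov A Q = Q + Aᵀ * lyapunov A Q * A := by
  have hP := hA.hasSum_lyapunov hγ0 hγ1 Q
  have htail : HasSum (fun k => (A ^ (k + 1))ᵀ * Q * A ^ (k + 1)) (Aᵀ * lyapunov A Q * A) := by
    simpa only [pow_succ, Matrix.transpose_mul, Matrix.mul_assoc]
      using (hP.mul_left Aᵀ).mul_right A
  have htail' := ((hasSum_nat_add_iff' 1).2 hP).unique htail
  simp only [Finset.range_one, Finset.sum_singleton, pow_zero, Matrix.transpose_one, Matrix.one_mul,
    Matrix.mul_one] at htail'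
  rw [← htail', add_sub_cancel]

lemma IsStable.hasSum_trace_lyapunov (Y : Matrix (Fin n) (Fin n) ℝ) :
    HasSum (fun k => ((A ^ k * Y)ᵀ * Q * (A ^ k * Y)).trace) (Yᵀ * lyapunov A Q * Y).trace := by
  simpa only [Function.comp_def, Matrix.traceAddMonoidHom_apply, Matrix.transpose_mul,
    Matrix.mul_assoc] using (((hA.hasSum_lyapunov hγ0 hγ1 Q).mul_left Yᵀ).mul_right Y).map
      (Matrix.traceAddMonoidHom (Fin n) ℝ) continuous_id.matrix_trace

lemma IsStable.norm_lyapunov_mul_le :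
    ‖lyapunov A Q * A‖ ≤ τ ^ 2 * γ * ‖Q‖ / (1 - γ ^ 2) := by
  have hγ2 : γ ^ 2 < 1 := pow_lt_one₀ hγ0 hγ1 two_ne_zero
  rw [← ((hA.hasSum_lyapunov hγ0 hγ1 Q).mul_right A).tsum_eq, div_eq_mul_inv]
  refine tsum_of_norm_bounded
    ((hasSum_geometric_of_lt_one (sq_nonneg γ) hγ2).mul_left (τ ^ 2 * γ * ‖Q‖)) fun k => ?_
  rw [Matrix.mul_assoc, ← pow_succ]
  exact (hA.norm_transpose_pow_mul_mul_pow_le Q k (k + 1)).trans_eq (by ring)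

lemma IsStable.norm_add_transpose_mul_lyapunov_mul_le (B : Matrix (Fin n) (Fin m) ℝ)
    (S : Matrix (Fin m) (Fin n) ℝ) :
    ‖S + Bᵀ * lyapunov A Q * A‖ ≤ ‖S‖ + τ ^ 2 * γ * ‖B‖ * ‖Q‖ / (1 - γ ^ 2) :=
  calc ‖S + Bᵀ * lyapunov A Q * A‖ ≤ ‖S‖ + ‖Bᵀ * (lyapunov A Q * A)‖ := by
        rw [Matrix.mul_assoc]
        exact norm_add_le _ _
    _ ≤ ‖S‖ + ‖Bᵀ‖ * ‖lyapunov A Q * A‖ := by gcongr; exact Matrix.l2_opNorm_mul _ _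
    _ ≤ ‖S‖ + ‖B‖ * (τ ^ 2 * γ * ‖Q‖ / (1 - γ ^ 2)) := by
        rw [norm_transpose]
        gcongr
        exact hA.norm_lyapunov_mul_le hγ0 hγ1 Q
    _ = ‖S‖ + τ ^ 2 * γ * ‖B‖ * ‖Q‖ / (1 - γ ^ 2) := by ring

end

lemma IsStable.posSemidef_lyapunov (hA : IsStable A τ γ) (hγ0 : 0 ≤ γ) (hγ1 : γ < 1)
    {Q : Matrix (Fin n) (Fin n) ℝ} (hQ : Q.PosSemidef) : (lyapunov A Q).PosSemidef := by
  have hP := hA.hasSum_lyapunov hγ0 hγ1 Q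
  have hterm k : ((A ^ k)ᵀ * Q * A ^ k).PosSemidef := by
    simpa using hQ.conjTranspose_mul_mul_same (A ^ k)
  refine .of_dotProduct_mulVec_nonneg (hP.matrix_conjTranspose.unique ?_) fun x => ?_
  · simpa only [(hterm _).isHermitian.eq] using hP
  · have hquad : Continuous fun X : Matrix (Fin n) (Fin n) ℝ => star x ⬝ᵥ (X *ᵥ x) := by fun_prop
    exact ge_of_tendsto' ((hquad.tendsto _).comp hP) fun s =>
      (Matrix.posSemidef_sum s fun k _ => hterm k).dotProduct_mulVec_nonneg x

end Lyapunov

section ExcessCost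

variable {n m : ℕ} {A : Matrix (Fin n) (Fin n) ℝ} {B : Matrix (Fin n) (Fin m) ℝ}
  {Q : Matrix (Fin n) (Fin n) ℝ} {R : Matrix (Fin m) (Fin m) ℝ} {S : Matrix (Fin m) (Fin n) ℝ}
  {K : Matrix (Fin m) (Fin n) ℝ} {τ γ : ℝ}

lemma apply_zero_le_of_hasSum_of_sub_le {v f : ℕ → ℝ} {c : ℝ} (hf : HasSum f c)
    (hv : Tendsto v atTop (𝓝 0)) (h : ∀ k, v k - v (k + 1) ≤ f k) : v 0 ≤ c := by
  have hpartial N : v 0 - v N ≤ ∑ k ∈ Finset.range N, f k := by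
    rw [← Finset.sum_range_sub']
    exact Finset.sum_le_sum fun k _ => h k
  simpa using le_of_tendsto_of_tendsto' (hv.const_sub (v 0)) hf.tendsto_sum_nat hpartial

lemma IsStable.gainCost_zero_input_sub_le (hA : IsStable A τ γ) (hγ0 : 0 ≤ γ) (hγ1 : γ < 1)
    (hQ : Q.PosSemidef) (hR : R.PosSemidef) {Y : Matrix (Fin n) (Fin n) ℝ} {a c₁ c₂ : ℝ}
    (hY : ∀ k, ‖(A + B * K) ^ k * Y‖ ≤ a * γ ^ k)
    (h₁ : HasSum (fun k => gainCost Q R S (A ^ k * Y) 0) c₁)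
    (h₂ : HasSum (fun k =>
      gainCost Q R S ((A + B * K) ^ k * Y) (K * ((A + B * K) ^ k * Y))) c₂) :
    c₁ - c₂ ≤ 2 * n * a ^ 2 * ‖K‖ * (‖S‖ + τ ^ 2 * γ * ‖B‖ * ‖Q‖ / (1 - γ ^ 2))
      / (1 - γ ^ 2) := by
  have hγ2 : γ ^ 2 < 1 := pow_lt_one₀ hγ0 hγ1 two_ne_zero
  set P := lyapunov A Q
  set Z : ℕ → Matrix (Fin n) (Fin n) ℝ := fun k => (A + B * K) ^ k * Y with hZ
  set σ := ‖S‖ + τ ^ 2 * γ * ‖B‖ * ‖Q‖ / (1 - γ ^ 2)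
  have hσ : ‖S + Bᵀ * P * A‖ ≤ σ := hA.norm_add_transpose_mul_lyapunov_mul_le hγ0 hγ1 Q B S
  have hc₁ : c₁ = ((Z 0)ᵀ * P * Z 0).trace := by
    simp only [gainCost_zero_right] at h₁
    simpa [hZ] using h₁.unique (hA.hasSum_trace_lyapunov hγ0 hγ1 Q Y)
  have hcross k : ‖K * Z k‖ * ‖S + Bᵀ * P * A‖ * ‖Z k‖ ≤ a ^ 2 * ‖K‖ * σ * (γ ^ 2) ^ k := by
    have ha : 0 ≤ a * γ ^ k := (norm_nonneg _).trans (hY k)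
    calc ‖K * Z k‖ * ‖S + Bᵀ * P * A‖ * ‖Z k‖
        ≤ ‖K‖ * (a * γ ^ k) * σ * (a * γ ^ k) := by
          gcongr
          · exact (Matrix.l2_opNorm_mul _ _).trans (by gcongr; exact hY k)
          · exact hY k
      _ = a ^ 2 * ‖K‖ * σ * (γ ^ 2) ^ k := by ring
  have hstep k : ((Z k)ᵀ * P * Z k).trace - ((Z (k + 1))ᵀ * P * Z (k + 1)).trace
      ≤ gainCost Q R S (Z k) (K * Z k) + 2 * n * a ^ 2 * ‖K‖ * σ * (γ ^ 2) ^ k := by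
    have hZsucc : Z (k + 1) = A * Z k + B * (K * Z k) := by
      simp only [hZ, pow_succ', Matrix.add_mul, Matrix.mul_assoc]
    rw [hZsucc]
    refine (trace_sub_trace_le_gainCost_add (hA.posSemidef_lyapunov hγ0 hγ1 hQ) hR
      (hA.lyapunov_eq hγ0 hγ1 Q) B S (Z k) (K * Z k)).trans ?_
    rw [Fintype.card_fin]
    linear_combination 2 * (n : ℝ) * hcross k
  have hlim : Tendsto (fun k => ((Z k)ᵀ * P * Z k).trace) atTop (𝓝 0) :=
    (summable_trace_transpose_mul_mul P hγ0 hγ1 hY hY).tendsto_atTop_zero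
  have hgeo := (hasSum_geometric_of_lt_one (sq_nonneg γ) hγ2).mul_left (2 * n * a ^ 2 * ‖K‖ * σ)
  rw [hc₁, sub_le_iff_le_add', div_eq_mul_inv]
  exact apply_zero_le_of_hasSum_of_sub_le (h₂.add hgeo) hlim hstep

lemma IsStable.gainCost_equivalentDRC_sub_le (hA : IsStable A τ γ) (hK : IsStable (A + B * K) τ γ)
    (hγ0 : 0 ≤ γ) (hγ1 : γ < 1) (hQ : Q.PosSemidef) (hR : R.PosSemidef) {H : ℕ} {cL cK : ℝ}
    (hL : HasSum (fun j => gainCost Q R S (stateGain A B (drcGain H (equivalentDRC A B K)) j)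
      (drcGain H (equivalentDRC A B K) j)) cL)
    (hKc : HasSum (fun j => gainCost Q R S ((A + B * K) ^ j) (K * (A + B * K) ^ j)) cK) :
    cL - cK ≤ 2 * n * (τ * γ ^ H) ^ 2 * ‖K‖ *
      (‖S‖ + τ ^ 2 * γ * ‖B‖ * ‖Q‖ / (1 - γ ^ 2)) / (1 - γ ^ 2) := by
  simp only [stateGain_drcGain_equivalentDRC, drcGain_equivalentDRC] at hL
  have hLtail := (hasSum_nat_add_iff' H).2 hL
  have hKtail := (hasSum_nat_add_iff' H).2 hKc
  have hhead : ∑ j ∈ Finset.range H, gainCost Q R S (A ^ (j - H) * (A + B * K) ^ min j H)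
        (if j < H then K * (A + B * K) ^ j else 0)
      = ∑ j ∈ Finset.range H, gainCost Q R S ((A + B * K) ^ j) (K * (A + B * K) ^ j) :=
    Finset.sum_congr rfl fun j hj => by
      have hj : j < H := Finset.mem_range.1 hj
      simp [hj, hj.le]
  simp only [hhead, Nat.add_sub_cancel, Nat.min_eq_right (Nat.le_add_left _ _),
    Nat.not_lt.2 (Nat.le_add_left _ _), if_false] at hLtail
  simp only [pow_add] at hKtail
  rw [← sub_sub_sub_cancel_right cL cK]
  refine hA.gainCost_zero_input_sub_le hγ0 hγ1 hQ hR (fun k => ?_) hLtail hKtail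
  rw [← pow_add]
  exact (hK (k + H)).trans_eq (by ring)

end ExcessCost

lemma excess_bound_le {n : ℕ} {τ γ r b k q s : ℝ} (hτ : 0 < n → 1 ≤ τ) (hγ0 : 0 ≤ γ)
    (hγ1 : γ < 1) (hr : 0 ≤ r) (hb : 0 ≤ b) (hk : 0 ≤ k) (hq : 0 ≤ q) (hs : 0 ≤ s) (H : ℕ) :
    2 * n * (τ * γ ^ H) ^ 2 * k * (s + τ ^ 2 * γ * b * q / (1 - γ ^ 2)) / (1 - γ ^ 2)
      ≤ (n : ℝ) ^ 2 * (γ ^ 2) ^ H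
        * (r + 4 * τ ^ 4 * (b * k ^ 2 + k) * (b * q + s) / (1 - γ ^ 2) ^ 3) := by
  obtain rfl | hn := n.eq_zero_or_pos
  · simp
  have hn1 : (1 : ℝ) ≤ n := by exact_mod_cast hn
  have hτ1 : 1 ≤ τ ^ 2 := one_le_pow₀ (hτ hn)
  have hd0 : 0 < 1 - γ ^ 2 := sub_pos.2 (pow_lt_one₀ hγ0 hγ1 two_ne_zero)
  have hd1 : 1 - γ ^ 2 ≤ 1 := sub_le_self 1 (sq_nonneg γ)
  set d := 1 - γ ^ 2
  have hσ : s + τ ^ 2 * γ * b * q / d ≤ τ ^ 2 * (b * q + s) / d :=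
    calc s + τ ^ 2 * γ * b * q / d ≤ τ ^ 2 * s / d + τ ^ 2 * 1 * b * q / d := by
          gcongr
          rw [le_div_iff₀ hd0]
          exact (mul_le_of_le_one_right hs hd1).trans (le_mul_of_one_le_left hs hτ1)
      _ = τ ^ 2 * (b * q + s) / d := by ring
  have hk' : k ≤ 2 * (b * k ^ 2 + k) / d := by
    rw [le_div_iff₀ hd0]
    have := mul_le_of_le_one_right hk hd1
    have : 0 ≤ b * k ^ 2 := by positivity
    linarith
  calc 2 * n * (τ * γ ^ H) ^ 2 * k * (s + τ ^ 2 * γ * b * q / d) / d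
      ≤ 2 * n * (τ * γ ^ H) ^ 2 * (2 * (b * k ^ 2 + k) / d) * (τ ^ 2 * (b * q + s) / d) / d := by
        gcongr
    _ = n * (γ ^ 2) ^ H * (4 * τ ^ 4 * (b * k ^ 2 + k) * (b * q + s) / d ^ 3) := by
        field_simp
        ring
    _ ≤ (n : ℝ) ^ 2 * (γ ^ 2) ^ H
        * (r + 4 * τ ^ 4 * (b * k ^ 2 + k) * (b * q + s) / d ^ 3) := by
        gcongr
        · exact le_self_pow₀ hn1 two_ne_zero
        · exact le_add_of_nonneg_left hr

end LQR

theorem mainTheorem3_general {Ω : Type*} [MeasurableSpace Ω] (μ : Measure Ω)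
    [IsProbabilityMeasure μ] {nx nu : ℕ}
    (A : Matrix (Fin nx) (Fin nx) ℝ) (B : Matrix (Fin nx) (Fin nu) ℝ)
    {Q : Matrix (Fin nx) (Fin nx) ℝ} {R : Matrix (Fin nu) (Fin nu) ℝ}
    (S : Matrix (Fin nu) (Fin nx) ℝ) (hQ : Q.PosSemidef) (hR : R.PosSemidef)
    (x₀ : Fin nx → ℝ) {w : ℕ → Ω → (Fin nx → ℝ)} (hw : LQR.IsWhiteNoise μ w)
    {τ γ : ℝ} (hγ0 : 0 ≤ γ) (hγ1 : γ < 1) (hA : LQR.IsStable A τ γ)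
    {K : Matrix (Fin nu) (Fin nx) ℝ} (hK : LQR.IsStable (A + B * K) τ γ) (H : ℕ) :
    ∃ cL cK : ℝ,
      LQR.HasDRCCost μ A B Q R S x₀ w H (LQR.equivalentDRC A B K) cL ∧
      LQR.HasFeedbackCost μ A B Q R S x₀ w K cK ∧
      cL - cK ≤ 2 * nx * (τ * γ ^ H) ^ 2 * ‖K‖ *
        (‖S‖ + τ ^ 2 * γ * ‖B‖ * ‖Q‖ / (1 - γ ^ 2)) / (1 - γ ^ 2) := by
  obtain ⟨cL, hL⟩ := LQR.summable_gainCost Q R S hγ0 hγ1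
    (hA.norm_stateGain_drcGain_equivalentDRC_le hK H) (hK.norm_drcGain_equivalentDRC_le hγ0 H)
  obtain ⟨cK, hKc⟩ := LQR.summable_gainCost Q R S hγ0 hγ1 hK (hK.norm_mul_pow_le K)
  exact ⟨cL, cK, hw.hasDRCCost hA hγ0 hγ1 x₀ hL, hw.hasFeedbackCost hK hγ0 hγ1 x₀ hKc,
    hA.gainCost_equivalentDRC_sub_le hK hγ0 hγ1 hQ hR hL hKc⟩

theorem mainTheorem3 {Ω : Type*} [MeasurableSpace Ω] (μ : Measure Ω) [IsProbabilityMeasure μ]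
    {nx nu : ℕ}
    (A : Matrix (Fin nx) (Fin nx) ℝ) (B : Matrix (Fin nx) (Fin nu) ℝ)
    (Q : Matrix (Fin nx) (Fin nx) ℝ) (R : Matrix (Fin nu) (Fin nu) ℝ)
    (S : Matrix (Fin nu) (Fin nx) ℝ)
    (hQRS : (Matrix.fromBlocks Q Sᵀ S R).PosSemidef)
    (x₀ : Fin nx → ℝ) (w : ℕ → Ω → (Fin nx → ℝ)) (hw : LQR.IsWhiteNoise μ w)
    (τ ρ : ℝ) (hρ : 0 < ρ)
    (hA : LQR.IsStable A τ (Real.exp (-ρ)))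
    (K : Matrix (Fin nu) (Fin nx) ℝ)
    (hK : LQR.IsStable (A + B * K) τ (Real.exp (-ρ)))
    (H : ℕ) :
    ∃ cL cK : ℝ,
      LQR.HasDRCCost μ A B Q R S x₀ w H (LQR.equivalentDRC A B K) cL ∧
      LQR.HasFeedbackCost μ A B Q R S x₀ w K cK ∧
      cL - cK ≤ (nx : ℝ) ^ 2 * Real.exp (-2 * ρ * H) *
        (‖R‖ + 4 * τ ^ 4 * (‖B‖ * ‖K‖ ^ 2 + ‖K‖) * (‖B‖ * ‖Q‖ + ‖S‖) /
          (1 - Real.exp (-2 * ρ)) ^ 3) := by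
  have hγ1 : Real.exp (-ρ) < 1 := Real.exp_lt_one_iff.2 (neg_lt_zero.2 hρ)
  obtain ⟨cL, cK, hL, hKc, hgap⟩ := mainTheorem3_general μ A B S (hQRS.submatrix Sum.inl)
    (hQRS.submatrix Sum.inr) x₀ hw (Real.exp_nonneg _) hγ1 hA hK H
  have hexp : Real.exp (-2 * ρ) = Real.exp (-ρ) ^ 2 := by
    rw [← Real.exp_nat_mul]
    ring_nf
  have hexpH : Real.exp (-2 * ρ * H) = (Real.exp (-ρ) ^ 2) ^ H := by
    rw [← hexp, ← Real.exp_nat_mul, mul_comm]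
  rw [hexp, hexpH]
  exact ⟨cL, cK, hL, hKc, hgap.trans (LQR.excess_bound_le hA.one_le (Real.exp_nonneg _) hγ1
    (norm_nonneg _) (norm_nonneg _) (norm_nonneg _) (norm_nonneg _) (norm_nonneg _) H)⟩
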